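/- Let $n_0\ge 1$, $n\ge 1$ and let $\Phi:\mathbb R\to\mathbb R$ be differentiable with $\Phi$ and $\Phi'$ bounded. For a width $n_1\ge 1$, an input $x\in\mathbb R^{n_0}$ and parameters $\theta=(\theta^{(0)},\theta^{(1)})\in\mathbb R^{n_0\times n_1}\times\mathbb R^{n_1}$, let $$f(x;\theta)=\frac1{\sqrt{n_1}}\sum_{j=1}^{n_1}\Phi\Big(\frac1{\sqrt{n_0}}\sum_{i=1}^{n_0}x_i\theta^{(0)}_{ij}\Big)\theta^{(1)}_j,\qquad k(x,x';\theta)=\langle\nabla_\theta f(x;\theta),\nabla_\theta f(x';\theta)\rangle$$ be the output of the shallow network and its empirical neural tangent kernel. Put $\tilde{\mathcal K}(x,x')=\frac1{n_0}x^\top x'$ and $$\mathcal K(x,x')=\mathbb E[\Phi(u)\Phi(v)],\qquad k_\infty(x,x')=\mathcal K(x,x')+\tilde{\mathcal K}(x,x')\,\mathbb E[\Phi'(u)\Phi'(v)],$$ where $(u,v)$ is a centered Gaussian pair with $\mathbb E[u^2]=\tilde{\mathcal K}(x,x)$, $\mathbb E[uv]=\tilde{\mathcal K}(x,x')$, $\mathbb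 E[v^2]=\tilde{\mathcal K}(x',x')$. Fix training inputs $\mathcal X=(x_1,\dots,x_n)$ in $\mathbb R^{n_0}$, and let the entries of $\theta$ be i.i.d. standard Gaussian. Let $k_0=(k(x_i,x_j;\theta))_{i,j}$, $f_0=(f(x_i;\theta))_i$, let $k_\infty=(k_\infty(x_i,x_j))_{i,j}$ (a deterministic matrix), and let $G_0$ be a centered Gaussian vector in $\mathbb R^n$ with covariance matrix $(\mathcal K(x_i,x_j))_{i,j}$. Then for every $p\in[1,\infty)$ there is a constant $C>0$, not depending on the width (it may depend on $p$, $n_0$, $\Phi$ and $\mathcal X$), such that for every $n_1\ge 1$ $$\mathcal W_p\big((k_0,f_0),(k_\infty,G_0)\big)\le\frac{C}{\sqrt{n_1}},$$ where $\mathcal W_p$ is the $p$-Wasserstein distance between the laws on $\mathbb R^{n\times n}\times\mathbb R^n$ with the Euclidean metric (Frobenius norm on matrices). -/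

import Mathlib

open MeasureTheory ProbabilityTheory
open scoped ENNReal

namespace ShallowNTK

noncomputable section

/-! ### Wasserstein distances -/

/-- The couplings of two measures: measures on the product with the given marginals. -/
def Couplings {M : Type*} [MeasurableSpace M] (μ ν : Measure M) : Set (Measure (M × M)) :=
  {γ | γ.map Prod.fst = μ ∧ γ.map Prod.snd = ν}

/-- The `p`-Wasserstein distance, `1 ≤ p < ∞`, as an extended nonnegative real:
the infimum over all couplings of `(E[d(X, Y) ^ p]) ^ (1 / p)`. -/
def wasserstein {M : Type*} [MeasurableSpace M] [PseudoEMetricSpace M] (p : ℝ)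
    (μ ν : Measure M) : ℝ≥0∞ :=
  ⨅ γ ∈ Couplings μ ν, (∫⁻ z, edist z.1 z.2 ^ p ∂γ) ^ (1 / p)

/-! ### The network -/

/-- Inputs, with the Euclidean norm. -/
abbrev Input (n₀ : ℕ) : Type := EuclideanSpace ℝ (Fin n₀)

/-- Parameters `θ = (θ⁽⁰⁾, θ⁽¹⁾)` with `θ⁽⁰⁾ ∈ ℝ^(n₀ × n₁)` and `θ⁽¹⁾ ∈ ℝ^n₁`. -/
abbrev Param (n₀ n₁ : ℕ) : Type := EuclideanSpace ℝ ((Fin n₀ × Fin n₁) ⊕ Fin n₁)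

/-- The preactivation of the `j`-th hidden neuron. -/
def preactivation {n₀ n₁ : ℕ} (x : Input n₀) (θ : Param n₀ n₁) (j : Fin n₁) : ℝ :=
  1 / √(n₀ : ℝ) * ∑ i, x i * θ (Sum.inl (i, j))

/-- The output `f(x; θ) = (1 / √n₁) Φ((1 / √n₀) x θ⁽⁰⁾) θ⁽¹⁾` of the network. -/
def network {n₀ n₁ : ℕ} (Φ : ℝ → ℝ) (x : Input n₀) (θ : Param n₀ n₁) : ℝ :=
  1 / √(n₁ : ℝ) * ∑ j, Φ (preactivation x θ j) * θ (Sum.inr j)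

/-- The empirical neural tangent kernel `k(x, x'; θ) = ⟨∇_θ f(x; θ), ∇_θ f(x'; θ)⟩`. -/
def ntk {n₀ n₁ : ℕ} (Φ : ℝ → ℝ) (x x' : Input n₀) (θ : Param n₀ n₁) : ℝ :=
  inner ℝ (gradient (network Φ x) θ) (gradient (network Φ x') θ)

/-- The law of the parameters at initialization: i.i.d. standard Gaussian entries. -/
def initLaw (n₀ n₁ : ℕ) : Measure (Param n₀ n₁) :=
  (Measure.pi fun _ => gaussianReal 0 1).map (WithLp.toLp 2)

/-! ### The limiting objects -/

/-- `K̃(x, x') = (1 / n₀) xᵀ x'`. -/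
def inputKernel {n₀ : ℕ} (x x' : Input n₀) : ℝ :=
  1 / (n₀ : ℝ) * ∑ i, x i * x' i

/-- The matrix `T(x, x')` of values of `K̃` at the pair `(x, x')`. -/
def pairCov {n₀ : ℕ} (x x' : Input n₀) : Matrix (Fin 2) (Fin 2) ℝ :=
  !![inputKernel x x, inputKernel x x'; inputKernel x' x, inputKernel x' x']

/-- `E[g(u) g(v)]` for `(u, v)` centered Gaussian with covariance matrix `T(x, x')`. -/
def pairExpectation {n₀ : ℕ} (g : ℝ → ℝ) (x x' : Input n₀) : ℝ :=
  ∫ w, g (w 0) * g (w 1) ∂(multivariateGaussian 0 (pairCov x x'))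

/-- The covariance kernel `K(x, x') = E[Φ(u) Φ(v)]` of the Gaussian approximation. -/
def gpKernel {n₀ : ℕ} (Φ : ℝ → ℝ) (x x' : Input n₀) : ℝ :=
  pairExpectation Φ x x'

/-- The limiting kernel `k_∞(x, x') = K(x, x') + K̃(x, x') E[Φ'(u) Φ'(v)]`. -/
def limitKernel {n₀ : ℕ} (Φ : ℝ → ℝ) (x x' : Input n₀) : ℝ :=
  gpKernel Φ x x' + inputKernel x x' * pairExpectation (deriv Φ) x x'

/-- The law of `G₀(X) = (G₀(x₁), …, G₀(xₙ))`, where `G₀` is the centered Gaussian process with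
covariance kernel `K`. (The covariance matrix is positive semidefinite, see
`gpCov_posSemidef` below.) -/
def gpLaw {n₀ n : ℕ} (Φ : ℝ → ℝ) (X : Fin n → Input n₀) : Measure (EuclideanSpace ℝ (Fin n)) :=
  multivariateGaussian 0 (Matrix.of fun i j => gpKernel Φ (X i) (X j))

/-! ### The joint laws on the training set -/

/-- Pairs of an `n × n` matrix, with the Frobenius norm, and a vector of `ℝⁿ`, with the Euclidean
norm; the product carries the Euclidean norm. -/
abbrev Joint (n : ℕ) : Type :=
  WithLp 2 (EuclideanSpace ℝ (Fin n × Fin n) × EuclideanSpace ℝ (Fin n))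

/-- The pair `(k(X, X; θ), f(X; θ))`. -/
def empiricalPair {n₀ n₁ n : ℕ} (Φ : ℝ → ℝ) (X : Fin n → Input n₀) (θ : Param n₀ n₁) : Joint n :=
  WithLp.toLp 2
    (WithLp.toLp 2 fun ij : Fin n × Fin n => ntk Φ (X ij.1) (X ij.2) θ,
      WithLp.toLp 2 fun i => network Φ (X i) θ)

/-- The joint law of `(k₀, f₀)` on the training set, at initialization. -/
def initJointLaw {n₀ n : ℕ} (n₁ : ℕ) (Φ : ℝ → ℝ) (X : Fin n → Input n₀) : Measure (Joint n) :=
  (initLaw n₀ n₁).map (empiricalPair Φ X)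

/-- The joint law of `(k_∞, G₀)` on the training set, where `k_∞` is deterministic. -/
def limitJointLaw {n₀ n : ℕ} (Φ : ℝ → ℝ) (X : Fin n → Input n₀) : Measure (Joint n) :=
  (gpLaw Φ X).map fun g =>
    WithLp.toLp 2 (WithLp.toLp 2 fun ij : Fin n × Fin n => limitKernel Φ (X ij.1) (X ij.2), g)

/-! ### The covariance matrices are positive semidefinite -/

/-- The matrix `T(x, x')` is positive semidefinite. -/
theorem pairCov_posSemidef {n₀ : ℕ} (x x' : Input n₀) : (pairCov x x').PosSemidef := by
  refine Matrix.PosSemidef.of_dotProduct_mulVec_nonneg ?_ fun v => ?_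
  · ext i j
    fin_cases i <;> fin_cases j <;> simp [pairCov, inputKernel, mul_comm]
  · have : star v ⬝ᵥ (pairCov x x').mulVec v
        = 1 / (n₀ : ℝ) * ∑ i, (v 0 * x i + v 1 * x' i) ^ 2 := by
      have e : ∀ i, (v 0 * x i + v 1 * x' i) ^ 2
          = v 0 * v 0 * (x i * x i) + v 0 * v 1 * (x i * x' i)
            + v 1 * v 0 * (x' i * x i) + v 1 * v 1 * (x' i * x' i) := fun i => by ring
      simp only [e, Finset.sum_add_distrib, ← Finset.mul_sum]
      simp [pairCov, inputKernel, Matrix.mulVec, dotProduct, Fin.sum_univ_two]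
      ring
    rw [this]
    positivity

/-- The Gaussian pair `(u, v)` realized through a standard Gaussian vector of `ℝ^n₀`. -/
theorem map_stdGaussian_eq_pair {n₀ : ℕ} (x x' : Input n₀) :
    (stdGaussian (Input n₀)).map (fun w => WithLp.toLp 2
      ![1 / √(n₀ : ℝ) * inner ℝ x w, 1 / √(n₀ : ℝ) * inner ℝ x' w])
      = multivariateGaussian 0 (pairCov x x') := by
  have hm : Measurable (fun w : Input n₀ => (WithLp.toLp 2
      ![1 / √(n₀ : ℝ) * inner ℝ x w, 1 / √(n₀ : ℝ) * inner ℝ x' w] :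
        EuclideanSpace ℝ (Fin 2))) := by
    refine (WithLp.measurable_toLp 2 _).comp (measurable_pi_lambda _ fun i => ?_)
    fin_cases i <;> simp <;> fun_prop
  apply Measure.ext_of_charFun
  ext t
  have h2 : ∀ w : Input n₀, inner ℝ (WithLp.toLp 2
      ![1 / √(n₀ : ℝ) * inner ℝ x w, 1 / √(n₀ : ℝ) * inner ℝ x' w] :
        EuclideanSpace ℝ (Fin 2)) t
      = inner ℝ w ((1 / √(n₀ : ℝ)) • (t 0 • x + t 1 • x')) := by
    intro w
    simp [PiLp.inner_apply, Fin.sum_univ_two, inner_smul_right, inner_add_right,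
      Finset.mul_sum, ← Finset.sum_add_distrib]
    refine Finset.sum_congr rfl fun i _ => ?_
    ring
  rw [charFun_multivariateGaussian (pairCov_posSemidef x x'), charFun_apply,
    integral_map hm.aemeasurable (by fun_prop)]
  simp_rw [h2]
  rw [← charFun_apply, charFun_stdGaussian]
  congr 1
  have h3 : ‖(1 / √(n₀ : ℝ)) • (t 0 • x + t 1 • x')‖ ^ 2
      = t.ofLp ⬝ᵥ (pairCov x x').mulVec t.ofLp := by
    have e : ∀ i, (t 0 * x i + t 1 * x' i) ^ 2
        = t 0 * t 0 * (x i * x i) + t 0 * t 1 * (x i * x' i)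
          + t 1 * t 0 * (x' i * x i) + t 1 * t 1 * (x' i * x' i) := fun i => by ring
    rw [norm_smul, mul_pow, EuclideanSpace.real_norm_sq_eq]
    simp only [PiLp.add_apply, PiLp.smul_apply, smul_eq_mul, e, Finset.sum_add_distrib,
      ← Finset.mul_sum]
    simp [pairCov, inputKernel, Matrix.mulVec, dotProduct, Fin.sum_univ_two]
    ring
  rw [← Complex.ofReal_pow, h3]
  simp
  ring

/-- For a bounded measurable `Φ`, the covariance matrix of `G₀(X)` is positive semidefinite. -/
theorem gpCov_posSemidef {n₀ n : ℕ} {Φ : ℝ → ℝ} (hΦ : Measurable Φ) {M : ℝ}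
    (hM : ∀ z, |Φ z| ≤ M) (X : Fin n → Input n₀) :
    (Matrix.of fun i j => gpKernel Φ (X i) (X j)).PosSemidef := by
  have hK : ∀ x x' : Input n₀, gpKernel Φ x x' = ∫ w, Φ (1 / √(n₀ : ℝ) * inner ℝ x w)
      * Φ (1 / √(n₀ : ℝ) * inner ℝ x' w) ∂(stdGaussian (Input n₀)) := by
    intro x x'
    have hm : Measurable (fun w : Input n₀ => (WithLp.toLp 2
        ![1 / √(n₀ : ℝ) * inner ℝ x w, 1 / √(n₀ : ℝ) * inner ℝ x' w] :
          EuclideanSpace ℝ (Fin 2))) := by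
      refine (WithLp.measurable_toLp 2 _).comp (measurable_pi_lambda _ fun i => ?_)
      fin_cases i <;> simp <;> fun_prop
    rw [gpKernel, pairExpectation, ← map_stdGaussian_eq_pair,
      integral_map hm.aemeasurable (Measurable.aestronglyMeasurable (by fun_prop))]
    simp
  have hint : ∀ x x' : Input n₀, Integrable (fun w => Φ (1 / √(n₀ : ℝ) * inner ℝ x w)
      * Φ (1 / √(n₀ : ℝ) * inner ℝ x' w)) (stdGaussian (Input n₀)) := by
    intro x x'
    refine Integrable.of_bound (Measurable.aestronglyMeasurable (by fun_prop)) (M * M)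
      (Filter.Eventually.of_forall fun w => ?_)
    rw [norm_mul]
    exact mul_le_mul (hM _) (hM _) (norm_nonneg _) ((abs_nonneg _).trans (hM 0))
  refine Matrix.PosSemidef.of_dotProduct_mulVec_nonneg ?_ fun v => ?_
  · ext i j
    simp [hK, mul_comm]
  · have : star v ⬝ᵥ (Matrix.of fun i j => gpKernel Φ (X i) (X j)).mulVec v
        = ∫ w, (∑ i, v i * Φ (1 / √(n₀ : ℝ) * inner ℝ (X i) w)) ^ 2
          ∂(stdGaussian (Input n₀)) := by
      have e : ∀ w : Input n₀, (∑ i, v i * Φ (1 / √(n₀ : ℝ) * inner ℝ (X i) w)) ^ 2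
          = ∑ i, ∑ j, v i * v j * (Φ (1 / √(n₀ : ℝ) * inner ℝ (X i) w)
            * Φ (1 / √(n₀ : ℝ) * inner ℝ (X j) w)) := by
        intro w
        rw [sq, Finset.sum_mul_sum]
        refine Finset.sum_congr rfl fun i _ => Finset.sum_congr rfl fun j _ => ?_
        ring
      simp_rw [e]
      rw [integral_finsetSum _ fun i _ => integrable_finsetSum _ fun j _ =>
        (hint (X i) (X j)).const_mul _]
      simp only [dotProduct, Matrix.mulVec, Matrix.of_apply, Pi.star_apply, star_trivial,
        Finset.mul_sum]
      refine Finset.sum_congr rfl fun i _ => ?_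
      rw [integral_finsetSum _ fun j _ => (hint (X i) (X j)).const_mul _]
      refine Finset.sum_congr rfl fun j _ => ?_
      rw [integral_const_mul, ← hK]
      ring
    rw [this]
    exact integral_nonneg fun w => sq_nonneg _

end

end ShallowNTK

/-! Conditionally on the hidden weights, the output `f₀` is exactly Gaussian, with covariance the
empirical second moment matrix `Σ̂` of the bounded features `φ(w)ᵢ = Φ(xᵢ·w/√n₀)`. So `f₀` has the
law of `√Σ̂ z` with `z` standard Gaussian independent of the weights, while `G₀` has the law of `√S
z` with `S = E Σ̂`. Using the same `z` for both gives a coupling of cost at most a constant times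
`‖Σ̂ - S‖_p ‖z‖_p`, provided the square root is Lipschitz at `S`.

For singular `S` this generally fails, the square root being only 1/2-Hölder, which would cost half
the rate. But `E (φ·v)² = v·Sv`, so almost surely `Σ̂` vanishes on `ker S`, and along such matrices
the square root is Lipschitz at `S` (`exists_norm_sqrt_sub_sqrt_le`,
`ae_empiricalCov_mulVec_eq_zero`). No nondegeneracy of the inputs is needed.

Both `Σ̂` and the kernel `k₀` are averages over i.i.d. neurons of variables with an exponential
moment, hence lie within `O(1/√n₁)` of their means in every `L^p`
(`exists_eLpNorm_mean_sub_integral_le`); the mean of `k₀` is `k_∞`.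

The coupling of `f₀` with `G₀` forgets the weights that determine `k₀`. Disintegration restores them
(`exists_lift_of_map_fst_eq`), and since `k_∞` is deterministic, Minkowski's inequality adds the two
errors. -/

namespace ShallowNTK

/-! ### Moments of sample means -/

/-- Second-order Taylor remainder of the exponential. Keeping the linear term exact lets it cancel
on integrating a centered variable. -/
theorem exp_le_one_add_add_sq_mul_exp_abs (x : ℝ) :
    Real.exp x ≤ 1 + x + x ^ 2 * Real.exp |x| := by
  have h := Complex.norm_exp_sub_sum_le_norm_mul_exp (x : ℂ) 2
  have e : Complex.exp (x : ℂ) - ∑ m ∈ Finset.range 2, (x : ℂ) ^ m / (m.factorial : ℂ)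
      = ((Real.exp x - (1 + x) : ℝ) : ℂ) := by
    simp [Finset.sum_range_succ]
  rw [e, Complex.norm_real, Complex.norm_real, Real.norm_eq_abs, Real.norm_eq_abs, sq_abs] at h
  linarith [le_abs_self (Real.exp x - (1 + x))]

/-- Half of the exponent `s` absorbs the factor `y ^ 2`, the other half absorbs `exp |t * y|`. What
remains is integrable, with all dependence on `t` in the factor `t ^ 2`. -/
theorem sq_mul_exp_le {s t y : ℝ} (hs : 0 < s) (ht : |t| ≤ s / 2) :
    (t * y) ^ 2 * Real.exp |t * y| ≤ t ^ 2 * (8 / s ^ 2 * Real.exp (s * |y|)) := by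
  have h1 : y ^ 2 ≤ 8 / s ^ 2 * Real.exp (s / 2 * |y|) := by
    have h := Real.pow_div_factorial_le_exp (x := s / 2 * |y|) (by positivity) 2
    have e : (s / 2 * |y|) ^ 2 / ((2 : ℕ).factorial : ℝ) = s ^ 2 / 8 * y ^ 2 := by
      rw [mul_pow, sq_abs]; norm_num [Nat.factorial]; ring
    rw [e] at h
    calc y ^ 2 = 8 / s ^ 2 * (s ^ 2 / 8 * y ^ 2) := by field_simp
      _ ≤ _ := by gcongr
  have h2 : Real.exp |t * y| ≤ Real.exp (s / 2 * |y|) := by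
    rw [abs_mul]; gcongr
  calc (t * y) ^ 2 * Real.exp |t * y| = t ^ 2 * (y ^ 2 * Real.exp |t * y|) := by ring
    _ ≤ t ^ 2 * (8 / s ^ 2 * Real.exp (s / 2 * |y|) * Real.exp (s / 2 * |y|)) := by gcongr
    _ = t ^ 2 * (8 / s ^ 2 * Real.exp (s * |y|)) := by
      rw [mul_assoc, ← Real.exp_add]; ring_nf

section SampleMean

variable {E : Type*} [MeasurableSpace E] {ν : Measure E}

theorem integrable_exp_mul_of_abs_le {g : E → ℝ} (hg : Measurable g) {s t : ℝ}
    (hi : Integrable (fun x => Real.exp (s * |g x|)) ν) (ht : |t| ≤ s) :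
    Integrable (fun x => Real.exp (t * g x)) ν := by
  refine hi.mono' (by fun_prop) (Filter.Eventually.of_forall fun x => ?_)
  rw [Real.norm_eq_abs, Real.abs_exp]
  refine Real.exp_le_exp.2 ((le_abs_self _).trans ?_)
  rw [abs_mul]
  gcongr

theorem integrable_of_integrable_exp_abs {g : E → ℝ} (hg : Measurable g) {s : ℝ} (hs : 0 < s)
    (hi : Integrable (fun x => Real.exp (s * |g x|)) ν) : Integrable g ν := by
  refine (hi.const_mul s⁻¹).mono' hg.aestronglyMeasurable (Filter.Eventually.of_forall fun x => ?_)
  rw [Real.norm_eq_abs]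
  have := Real.add_one_le_exp (s * |g x|)
  rw [inv_mul_eq_div, le_div_iff₀ hs]
  linarith

/-- A centered variable with an exponential moment is subgaussian near the origin. -/
theorem exists_integral_exp_le [IsProbabilityMeasure ν] {g : E → ℝ} (hg : Measurable g) {s : ℝ}
    (hs : 0 < s) (hi : Integrable (fun x => Real.exp (s * |g x|)) ν) (h0 : ∫ x, g x ∂ν = 0) :
    ∃ K : ℝ, ∀ t : ℝ, |t| ≤ s / 2 → ∫ x, Real.exp (t * g x) ∂ν ≤ Real.exp (K * t ^ 2) := by
  refine ⟨∫ x, 8 / s ^ 2 * Real.exp (s * |g x|) ∂ν, fun t ht => ?_⟩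
  have hgi : Integrable g ν := integrable_of_integrable_exp_abs hg hs hi
  have hl : Integrable (fun x => 1 + t * g x) ν := (integrable_const _).add (hgi.const_mul _)
  have hb : Integrable (fun x => (1 + t * g x) + t ^ 2 * (8 / s ^ 2 * Real.exp (s * |g x|))) ν :=
    hl.add ((hi.const_mul _).const_mul _)
  calc ∫ x, Real.exp (t * g x) ∂ν
      ≤ ∫ x, (1 + t * g x) + t ^ 2 * (8 / s ^ 2 * Real.exp (s * |g x|)) ∂ν := by
        refine integral_mono (integrable_exp_mul_of_abs_le hg hi (by linarith)) hb fun x => ?_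
        exact (exp_le_one_add_add_sq_mul_exp_abs _).trans
          (add_le_add_right (sq_mul_exp_le hs ht) _)
    _ = 1 + t ^ 2 * ∫ x, 8 / s ^ 2 * Real.exp (s * |g x|) ∂ν := by
        rw [integral_add hl ((hi.const_mul _).const_mul _), integral_add (integrable_const _) (hgi.const_mul _),
          integral_const_mul, integral_const_mul, h0]
        simp
    _ ≤ _ := by
        rw [add_comm, mul_comm]
        exact Real.add_one_le_exp _

/-- Independence turns the exponential moment of the sum into an `n`-th power; the bound stays
uniform in `n` when `t` is of order `1 / √n`. -/
theorem lintegral_exp_mul_sum_le [IsProbabilityMeasure ν] {g : E → ℝ} (hg : Measurable g)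
    {s K t : ℝ} (hi : Integrable (fun x => Real.exp (s * |g x|)) ν)
    (hK : ∫ x, Real.exp (t * g x) ∂ν ≤ Real.exp (K * t ^ 2)) (ht : |t| ≤ s) (n : ℕ) :
    ∫⁻ ω : Fin n → E, ENNReal.ofReal (Real.exp (t * ∑ j, g (ω j))) ∂(Measure.pi fun _ => ν)
      ≤ ENNReal.ofReal (Real.exp (K * (n * t ^ 2))) := by
  have he : ∀ ω : Fin n → E, Real.exp (t * ∑ j, g (ω j)) = ∏ j, Real.exp (t * g (ω j)) :=
    fun ω => by rw [Finset.mul_sum, Real.exp_sum]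
  simp_rw [he]
  rw [← ofReal_integral_eq_lintegral_ofReal
    (Integrable.fintype_prod fun _ => integrable_exp_mul_of_abs_le hg hi ht)
    (Filter.Eventually.of_forall fun ω => Finset.prod_nonneg fun _ _ => (Real.exp_pos _).le),
    integral_fintype_prod_eq_pow (fun x => Real.exp (t * g x))]
  refine ENNReal.ofReal_le_ofReal ?_
  rw [Fintype.card_fin, show K * (n * t ^ 2) = n * (K * t ^ 2) by ring, Real.exp_nat_mul]
  exact pow_le_pow_left₀ (integral_nonneg fun _ => (Real.exp_pos _).le) hK n

/-- Chernoff-type argument: `|y| ^ p ≤ (p / T) ^ p * max (exp (T y)) (exp (-T y))` with `T` of order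
`√n` produces the rate from `T` alone. -/
theorem exists_eLpNorm_mean_le_of_centered [IsProbabilityMeasure ν] {g : E → ℝ}
    (hg : Measurable g) {s : ℝ} (hs : 0 < s)
    (hi : Integrable (fun x => Real.exp (s * |g x|)) ν) (h0 : ∫ x, g x ∂ν = 0)
    {p : ℝ} (hp : 1 ≤ p) :
    ∃ C : ℝ, 0 ≤ C ∧ ∀ n : ℕ, 0 < n →
      eLpNorm (fun ω : Fin n → E => 1 / (n : ℝ) * ∑ j, g (ω j)) (ENNReal.ofReal p)
        (Measure.pi fun _ => ν) ≤ ENNReal.ofReal (C / √(n : ℝ)) := by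
  obtain ⟨K, hK⟩ := exists_integral_exp_le hg hs hi h0
  have hp0 : 0 < p := by linarith
  set τ : ℝ := s / 2 with hτ
  have hτ0 : 0 < τ := by positivity
  set B : ℝ := 2 * Real.exp (K * τ ^ 2)
  refine ⟨p / τ * B ^ (1 / p), by positivity, fun n hn => ?_⟩
  have hn1 : (1 : ℝ) ≤ n := by exact_mod_cast hn
  have hsn : 1 ≤ √(n : ℝ) := Real.one_le_sqrt.2 hn1
  have hsq : √(n : ℝ) ^ 2 = n := Real.sq_sqrt (by positivity)
  -- The parameter `τ * √n` for the mean is the parameter `t` for the sum. Then `n * t ^ 2 = τ ^ 2`,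
  -- so the two exponential moments at `±t` total at most `B`, whatever `n`.
  set t : ℝ := τ / √(n : ℝ) with ht
  have ht0 : 0 < t := by positivity
  have htτ : |t| ≤ τ := by rw [abs_of_pos ht0]; exact div_le_self hτ0.le hsn
  have hnt : (n : ℝ) * t ^ 2 = τ ^ 2 := by rw [ht, div_pow, hsq]; field_simp
  have htn : τ * √(n : ℝ) * (1 / n) = t := by
    rw [ht]; nth_rewrite 2 [← hsq]; field_simp
  have hpw : ∀ ω : Fin n → E, ‖1 / (n : ℝ) * ∑ j, g (ω j)‖ₑ ^ p
      ≤ ENNReal.ofReal ((p / (τ * √(n : ℝ))) ^ p)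
        * (ENNReal.ofReal (Real.exp (t * ∑ j, g (ω j)))
          + ENNReal.ofReal (Real.exp (-t * ∑ j, g (ω j)))) := by
    intro ω
    rw [Real.enorm_eq_ofReal_abs, ENNReal.ofReal_rpow_of_nonneg (abs_nonneg _) hp0.le,
      ← ENNReal.ofReal_add (Real.exp_pos _).le (Real.exp_pos _).le,
      ← ENNReal.ofReal_mul (by positivity)]
    refine ENNReal.ofReal_le_ofReal ((rpow_abs_le_mul_max_exp_of_pos _ hp0.le
      (t := τ * √(n : ℝ)) (by positivity)).trans ?_)
    rw [neg_mul, ← mul_assoc (τ * √(n : ℝ)), htn, neg_mul]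
    gcongr
    exact max_le_add_of_nonneg (Real.exp_pos _).le (Real.exp_pos _).le
  rw [eLpNorm_eq_lintegral_rpow_enorm_toReal (by simpa using hp0) ENNReal.ofReal_ne_top,
    ENNReal.toReal_ofReal hp0.le]
  have hlin : ∫⁻ ω : Fin n → E, ‖1 / (n : ℝ) * ∑ j, g (ω j)‖ₑ ^ p ∂(Measure.pi fun _ => ν)
      ≤ ENNReal.ofReal ((p / (τ * √(n : ℝ))) ^ p * B) := by
    have h1 := lintegral_exp_mul_sum_le hg hi (hK t htτ) (by linarith) n
    have h2 := lintegral_exp_mul_sum_le hg hi (t := -t) (hK (-t) (by rwa [abs_neg]))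
      (by rw [abs_neg]; linarith) n
    rw [neg_sq, hnt] at h2
    rw [hnt] at h1
    calc _ ≤ _ := lintegral_mono hpw
      _ = ENNReal.ofReal ((p / (τ * √(n : ℝ))) ^ p)
          * (∫⁻ ω : Fin n → E, ENNReal.ofReal (Real.exp (t * ∑ j, g (ω j)))
              ∂(Measure.pi fun _ => ν)
            + ∫⁻ ω : Fin n → E, ENNReal.ofReal (Real.exp (-t * ∑ j, g (ω j)))
              ∂(Measure.pi fun _ => ν)) := by
          rw [lintegral_const_mul _ (by fun_prop), lintegral_add_left (by fun_prop)]
      _ ≤ _ := by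
          rw [ENNReal.ofReal_mul (by positivity)]
          gcongr
          refine (add_le_add h1 h2).trans_eq ?_
          rw [← ENNReal.ofReal_add (Real.exp_pos _).le (Real.exp_pos _).le, ← two_mul]
  refine (ENNReal.rpow_le_rpow hlin (by positivity)).trans_eq ?_
  rw [ENNReal.ofReal_rpow_of_nonneg (by positivity) (by positivity),
    Real.mul_rpow (by positivity) (by positivity), ← Real.rpow_mul (by positivity),
    mul_one_div_cancel hp0.ne', Real.rpow_one]
  congr 1
  field_simp

/-- The `L^p` error of the sample mean of `n` independent copies of a variable with an exponential
moment is `O(1 / √n)`. -/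
theorem exists_eLpNorm_mean_sub_integral_le [IsProbabilityMeasure ν] {h : E → ℝ}
    (hm : Measurable h) {s : ℝ} (hs : 0 < s)
    (hi : Integrable (fun x => Real.exp (s * |h x|)) ν) {p : ℝ} (hp : 1 ≤ p) :
    ∃ C : ℝ, 0 ≤ C ∧ ∀ n : ℕ, 0 < n →
      eLpNorm (fun ω : Fin n → E => 1 / (n : ℝ) * ∑ j, h (ω j) - ∫ x, h x ∂ν)
        (ENNReal.ofReal p) (Measure.pi fun _ => ν) ≤ ENNReal.ofReal (C / √(n : ℝ)) := by
  set m := ∫ x, h x ∂ν with hm_def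
  have hi' : Integrable (fun x => Real.exp (s * |h x - m|)) ν := by
    refine (hi.const_mul (Real.exp (s * |m|))).mono' (by fun_prop)
      (Filter.Eventually.of_forall fun x => ?_)
    rw [Real.norm_eq_abs, Real.abs_exp, ← Real.exp_add, ← mul_add, add_comm |m|]
    gcongr
    exact abs_sub _ _
  obtain ⟨C, hC0, hC⟩ := exists_eLpNorm_mean_le_of_centered (hm.sub_const m) hs hi'
    (by rw [integral_sub (integrable_of_integrable_exp_abs hm hs hi) (integrable_const _)]
        simp [hm_def]) hp
  refine ⟨C, hC0, fun n hn => ?_⟩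
  have hn0 : (n : ℝ) ≠ 0 := by exact_mod_cast hn.ne'
  convert hC n hn using 3 with ω
  rw [Finset.sum_sub_distrib, mul_sub]
  simp [hn0]

theorem exists_eLpNorm_sum_abs_mean_sub_integral_le [IsProbabilityMeasure ν] {κ : Type*}
    [Fintype κ] {h : κ → E → ℝ} (hm : ∀ k, Measurable (h k))
    (hi : ∀ k, ∃ s : ℝ, 0 < s ∧ Integrable (fun x => Real.exp (s * |h k x|)) ν)
    {p : ℝ} (hp : 1 ≤ p) :
    ∃ C : ℝ, 0 ≤ C ∧ ∀ n : ℕ, 0 < n →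
      eLpNorm (fun ω : Fin n → E => ∑ k, |1 / (n : ℝ) * ∑ j, h k (ω j) - ∫ x, h k x ∂ν|)
        (ENNReal.ofReal p) (Measure.pi fun _ => ν) ≤ ENNReal.ofReal (C / √(n : ℝ)) := by
  choose s hs hi using hi
  choose C hC0 hC using fun k => exists_eLpNorm_mean_sub_integral_le (hm k) (hs k) (hi k) hp
  refine ⟨∑ k, C k, Finset.sum_nonneg fun k _ => hC0 k, fun n hn => ?_⟩
  have e : (fun ω : Fin n → E => ∑ k, |1 / (n : ℝ) * ∑ j, h k (ω j) - ∫ x, h k x ∂ν|)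
      = ∑ k, fun ω : Fin n → E => |1 / (n : ℝ) * ∑ j, h k (ω j) - ∫ x, h k x ∂ν| := by
    ext ω; simp
  rw [e, Finset.sum_div,
    ENNReal.ofReal_sum_of_nonneg fun k _ => div_nonneg (hC0 k) (Real.sqrt_nonneg _)]
  refine (eLpNorm_sum_le (fun k _ => Measurable.aestronglyMeasurable (by fun_prop))
    (by rwa [ENNReal.one_le_ofReal])).trans (Finset.sum_le_sum fun k _ => ?_)
  exact (eLpNorm_norm (fun ω : Fin n → E =>
    1 / (n : ℝ) * ∑ j, h k (ω j) - ∫ x, h k x ∂ν)).trans_le (hC k n hn)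

end SampleMean

/-! ### Perturbation of matrix square roots -/

section Sqrt

open scoped MatrixOrder Matrix

variable {ι : Type*} [Fintype ι]

theorem exists_pos_le_of_ne_zero {r : ι → ℝ} (hr : ∀ i, 0 ≤ r i) :
    ∃ c : ℝ, 0 < c ∧ ∀ i, r i ≠ 0 → c ≤ r i := by
  have : ∀ᶠ c in nhdsWithin (0 : ℝ) (Set.Ioi 0), ∀ i, r i ≠ 0 → c ≤ r i := by
    refine Filter.eventually_all.2 fun i => ?_
    by_cases h : r i = 0
    · simp [h]
    · filter_upwards [Ioo_mem_nhdsGT ((hr i).lt_of_ne' h)] with c hc _ using hc.2.le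
  obtain ⟨c, hc, hc0⟩ := (this.and self_mem_nhdsWithin).exists
  exact ⟨c, hc0, hc⟩

variable [DecidableEq ι]

/-- A positive semidefinite matrix is bounded below by a positive constant on the orthogonal
complement of its kernel. -/
theorem exists_le_dotProduct_mulVec {R : Matrix ι ι ℝ} (hR : R.PosSemidef) :
    ∃ c : ℝ, 0 < c ∧ ∃ u : ι → ι → ℝ, (∀ i, R *ᵥ u i = 0) ∧
      ∀ v : ι → ℝ, (∀ i, u i ⬝ᵥ v = 0) → c * (v ⬝ᵥ v) ≤ v ⬝ᵥ R *ᵥ v := by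
  set b := hR.isHermitian.eigenvectorBasis
  set r := hR.isHermitian.eigenvalues
  have hRb : ∀ i, R *ᵥ (b i).ofLp = r i • (b i).ofLp := hR.isHermitian.mulVec_eigenvectorBasis
  obtain ⟨c, hc0, hc⟩ := exists_pos_le_of_ne_zero hR.eigenvalues_nonneg
  -- The nonzero `u i` form an eigenbasis of the kernel; the others are set to zero and impose no
  -- condition on `v`.
  refine ⟨c, hc0, fun i => if r i = 0 then (b i).ofLp else 0, fun i => ?_, fun v hv => ?_⟩
  · dsimp only
    split_ifs with h
    · rw [hRb, h, zero_smul]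
    · simp
  · set w : EuclideanSpace ℝ ι := WithLp.toLp 2 v
    have hin : ∀ x y : EuclideanSpace ℝ ι, inner ℝ x y = x.ofLp ⬝ᵥ y.ofLp := fun x y => by
      simp [PiLp.inner_apply, dotProduct, mul_comm]
    have h1 : v ⬝ᵥ v = ∑ i, ((b i).ofLp ⬝ᵥ v) ^ 2 := by
      have := b.sum_inner_mul_inner w w
      rw [hin] at this
      rw [← this]
      refine Finset.sum_congr rfl fun i _ => ?_
      rw [hin, hin, dotProduct_comm, sq]
    have h2 : v ⬝ᵥ R *ᵥ v = ∑ i, r i * ((b i).ofLp ⬝ᵥ v) ^ 2 := by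
      have := b.sum_inner_mul_inner w (WithLp.toLp 2 (R *ᵥ v))
      rw [hin] at this
      rw [← this]
      refine Finset.sum_congr rfl fun i _ => ?_
      rw [hin, hin]
      have hs : (b i).ofLp ⬝ᵥ R *ᵥ v = r i * ((b i).ofLp ⬝ᵥ v) := by
        have ht : Rᵀ = R := by simpa using hR.isHermitian.eq
        rw [Matrix.dotProduct_mulVec, ← Matrix.mulVec_transpose, ht, hRb, smul_dotProduct,
          smul_eq_mul]
      simp only [w, hs]
      rw [dotProduct_comm]
      ring
    rw [h1, h2, Finset.mul_sum]
    refine Finset.sum_le_sum fun i _ => ?_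
    by_cases h : r i = 0
    · have := hv i
      simp only [if_pos h] at this
      simp [this]
    · exact mul_le_mul_of_nonneg_right (hc i h) (sq_nonneg _)

theorem norm_toEuclideanCLM_le (X : Matrix ι ι ℝ) (z : EuclideanSpace ℝ ι) :
    ‖Matrix.toEuclideanCLM (𝕜 := ℝ) X z‖ ≤ √(∑ i, ∑ j, X i j ^ 2) * ‖z‖ := by
  rw [EuclideanSpace.norm_eq, EuclideanSpace.norm_eq, ← Real.sqrt_mul (by positivity)]
  refine Real.sqrt_le_sqrt ?_
  rw [Finset.sum_mul]
  refine Finset.sum_le_sum fun i _ => ?_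
  simp only [Matrix.ofLp_toEuclideanCLM, Matrix.mulVec, dotProduct, Real.norm_eq_abs, sq_abs]
  exact Finset.sum_mul_sq_le_sq_mul_sq _ _ _

/-- By symmetry of the root, `|√B v|² = v · B v`. -/
theorem mulVec_sqrt_eq_zero {B : Matrix ι ι ℝ} (hB : B.PosSemidef) {v : ι → ℝ}
    (hv : B *ᵥ v = 0) : CFC.sqrt B *ᵥ v = 0 := by
  have hS : (CFC.sqrt B).PosSemidef := Matrix.nonneg_iff_posSemidef.1 (CFC.sqrt_nonneg B)
  have ht : (CFC.sqrt B)ᵀ = CFC.sqrt B := by simpa using hS.isHermitian.eq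
  have h : (CFC.sqrt B *ᵥ v) ⬝ᵥ (CFC.sqrt B *ᵥ v) = 0 := by
    rw [Matrix.dotProduct_mulVec, ← Matrix.mulVec_transpose, ht, Matrix.mulVec_mulVec,
      CFC.sqrt_mul_sqrt_self _ hB.nonneg, hv, zero_dotProduct]
  exact dotProduct_self_eq_zero.1 h

/-- The matrix square root is Lipschitz at a positive semidefinite matrix `A`, along matrices that
vanish on the kernel of `A`. -/
theorem exists_norm_sqrt_sub_sqrt_le {A : Matrix ι ι ℝ} (hA : A.PosSemidef) :
    ∃ K : ℝ, 0 ≤ K ∧ ∃ u : ι → ι → ℝ, (∀ i, A *ᵥ u i = 0) ∧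
      ∀ B : Matrix ι ι ℝ, B.PosSemidef → (∀ i, B *ᵥ u i = 0) → ∀ z : EuclideanSpace ℝ ι,
        ‖Matrix.toEuclideanCLM (𝕜 := ℝ) (CFC.sqrt B) z
          - Matrix.toEuclideanCLM (𝕜 := ℝ) (CFC.sqrt A) z‖
        ≤ K * (∑ i, ∑ j, |B i j - A i j|) * ‖z‖ := by
  have hR : (CFC.sqrt A).PosSemidef := Matrix.nonneg_iff_posSemidef.1 (CFC.sqrt_nonneg A)
  obtain ⟨c, hc0, u, hu, hc⟩ := exists_le_dotProduct_mulVec hR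
  have hRR := CFC.sqrt_mul_sqrt_self A hA.nonneg
  refine ⟨c⁻¹, by positivity, u, fun i => ?_, fun B hB hBu z => ?_⟩
  · rw [← hRR, ← Matrix.mulVec_mulVec, hu, Matrix.mulVec_zero]
  have hS : (CFC.sqrt B).PosSemidef := Matrix.nonneg_iff_posSemidef.1 (CFC.sqrt_nonneg B)
  have hSS := CFC.sqrt_mul_sqrt_self B hB.nonneg
  set R := CFC.sqrt A
  set S := CFC.sqrt B
  set X := S - R with hX
  have hXh : X.IsHermitian := hS.isHermitian.sub hR.isHermitian
  have hXu : ∀ i, X *ᵥ u i = 0 := fun i => by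
    rw [hX, Matrix.sub_mulVec, hu, mulVec_sqrt_eq_zero hB (hBu i), sub_zero]
  -- Sylvester equation for the difference of the roots. Tested against `X`, it gives two
  -- nonnegative traces; the one with `S` is dropped, so no lower bound on `B` is needed.
  have hD : B - A = S * X + X * R := by rw [← hSS, ← hRR, hX]; noncomm_ring
  have h1 : (X * (B - A)).trace = (X * S * X).trace + (X * R * X).trace := by
    rw [hD, Matrix.mul_add, Matrix.trace_add, ← Matrix.mul_assoc, ← Matrix.mul_assoc,
      Matrix.mul_assoc X X R, Matrix.trace_mul_comm X (X * R)]
  have h2 : 0 ≤ (X * S * X).trace := by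
    have := hS.conjTranspose_mul_mul_same X
    rw [hXh.eq] at this
    exact this.trace_nonneg
  have hsym : ∀ i j, X i j = X j i := fun i j => by
    have := hXh.apply j i
    rwa [star_trivial] at this
  -- As `X` annihilates every `u k`, each of its rows is orthogonal to `ker R`, where `R` is at
  -- least `c`. Summing over rows yields the Frobenius norm.
  have h3 : c * ∑ i, ∑ j, X i j ^ 2 ≤ (X * R * X).trace := by
    rw [Finset.mul_sum]
    refine Finset.sum_le_sum fun i _ => ?_
    have h := hc (X i) fun k => by
      have := congrFun (hXu k) i
      rwa [Matrix.mulVec, dotProduct_comm] at this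
    have e1 : X i ⬝ᵥ X i = ∑ j, X i j ^ 2 := by simp [dotProduct, sq]
    have e2 : X i ⬝ᵥ R *ᵥ X i = (X * R * X) i i := by
      rw [Matrix.mul_assoc, Matrix.mul_apply]
      simp only [dotProduct, Matrix.mulVec, Matrix.mul_apply]
      refine Finset.sum_congr rfl fun j _ => ?_
      congr 1
      exact Finset.sum_congr rfl fun k _ => by rw [hsym i k]
    rw [e1, e2] at h
    exact h
  set F := ∑ i, ∑ j, X i j ^ 2 with hF
  have hF0 : 0 ≤ F := by positivity
  have h4 : (X * (B - A)).trace ≤ √F * ∑ i, ∑ j, |B i j - A i j| := by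
    have hle : ∀ i j, |X i j| ≤ √F := fun i j => by
      refine Real.abs_le_sqrt ?_
      refine (Finset.single_le_sum (f := fun j => X i j ^ 2) (fun _ _ => sq_nonneg _)
        (Finset.mem_univ j)).trans ?_
      exact Finset.single_le_sum (f := fun i => ∑ j, X i j ^ 2)
        (fun _ _ => Finset.sum_nonneg fun _ _ => sq_nonneg _) (Finset.mem_univ i)
    have e : (X * (B - A)).trace = ∑ i, ∑ j, X i j * (B i j - A i j) := by
      simp only [Matrix.trace, Matrix.diag, Matrix.mul_apply, Matrix.sub_apply]
      rw [Finset.sum_comm]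
      refine Finset.sum_congr rfl fun i _ => Finset.sum_congr rfl fun j _ => ?_
      rw [hsym j i]
    rw [e, Finset.mul_sum]
    refine Finset.sum_le_sum fun i _ => ?_
    rw [Finset.mul_sum]
    refine Finset.sum_le_sum fun j _ => (le_abs_self _).trans ?_
    rw [abs_mul]
    exact mul_le_mul_of_nonneg_right (hle i j) (abs_nonneg _)
  have h5 : √F ≤ c⁻¹ * ∑ i, ∑ j, |B i j - A i j| := by
    rcases hF0.eq_or_lt with h | h
    · rw [← h, Real.sqrt_zero]; positivity
    · have hq : 0 < √F := Real.sqrt_pos.2 h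
      have : c * (√F * √F) ≤ √F * ∑ i, ∑ j, |B i j - A i j| := by
        rw [Real.mul_self_sqrt hF0]; linarith
      rw [← div_eq_inv_mul, le_div_iff₀ hc0]
      nlinarith
  rw [← sub_apply, ← map_sub]
  exact (norm_toEuclideanCLM_le _ _).trans (mul_le_mul_of_nonneg_right h5 (norm_nonneg _))

open scoped Matrix.Norms.L2Operator in
-- Serves to make the coupling maps measurable.
theorem continuous_sqrt_comp {T : Type*} [TopologicalSpace T] {B : T → Matrix ι ι ℝ}
    (hB : Continuous B) (hpos : ∀ t, (B t).PosSemidef) : Continuous fun t => CFC.sqrt (B t) :=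
  CFC.continuousOn_sqrt.comp_continuous hB fun t => (hpos t).nonneg

end Sqrt

/-! ### Coupling the output of the network with its Gaussian limit -/

section Coupling

open scoped Matrix MatrixOrder

variable {E ι : Type*} [Fintype ι] {n : ℕ}

/-- The empirical second moment matrix of the features `φ`. -/
noncomputable def empiricalCov (φ : E → ι → ℝ) (w : Fin n → E) : Matrix ι ι ℝ :=
  Matrix.of fun i k => 1 / (n : ℝ) * ∑ j, φ (w j) i * φ (w j) k

/-- The output of a shallow network with hidden features `φ`. -/
noncomputable def featureOutput (φ : E → ι → ℝ) (ω : Fin n → E × ℝ) : EuclideanSpace ℝ ι :=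
  WithLp.toLp 2 fun i => 1 / √(n : ℝ) * ∑ j, φ (ω j).1 i * (ω j).2

theorem empiricalCov_mulVec (φ : E → ι → ℝ) (w : Fin n → E) (v : ι → ℝ) :
    empiricalCov φ w *ᵥ v = fun i => 1 / (n : ℝ) * ∑ j, φ (w j) i * (φ (w j) ⬝ᵥ v) := by
  ext i
  simp only [empiricalCov, Matrix.mulVec, dotProduct, Matrix.of_apply, Finset.mul_sum,
    Finset.sum_mul]
  rw [Finset.sum_comm]
  exact Finset.sum_congr rfl fun j _ => Finset.sum_congr rfl fun k _ => by ring

/-- A sum of squares, one per neuron: this gives positivity, and makes the conditional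
characteristic function of the output a product over neurons. -/
theorem dotProduct_empiricalCov_mulVec (φ : E → ι → ℝ) (w : Fin n → E) (v : ι → ℝ) :
    v ⬝ᵥ empiricalCov φ w *ᵥ v = ∑ j, (1 / √(n : ℝ) * (φ (w j) ⬝ᵥ v)) ^ 2 := by
  rw [empiricalCov_mulVec]
  have key : ∀ d : Fin n → ℝ, v ⬝ᵥ (fun i => 1 / (n : ℝ) * ∑ j, φ (w j) i * d j)
      = ∑ j, 1 / (n : ℝ) * ((∑ i, v i * φ (w j) i) * d j) := fun d => by
    simp only [dotProduct, Finset.mul_sum, Finset.sum_mul]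
    rw [Finset.sum_comm]
    exact Finset.sum_congr rfl fun j _ => Finset.sum_congr rfl fun i _ => by ring
  have h : ∀ j, (1 / √(n : ℝ) * (φ (w j) ⬝ᵥ v)) ^ 2
      = 1 / (n : ℝ) * ((∑ i, v i * φ (w j) i) * (φ (w j) ⬝ᵥ v)) := fun j => by
    rw [mul_pow, div_pow, Real.sq_sqrt (Nat.cast_nonneg _), ← dotProduct, dotProduct_comm v]
    ring
  rw [key, Finset.sum_congr rfl fun j _ => h j]

theorem empiricalCov_posSemidef (φ : E → ι → ℝ) (w : Fin n → E) :
    (empiricalCov φ w).PosSemidef := by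
  refine Matrix.PosSemidef.of_dotProduct_mulVec_nonneg ?_ fun v => ?_
  · ext i k
    simp [empiricalCov, mul_comm]
  · rw [star_trivial, dotProduct_empiricalCov_mulVec]
    positivity

variable [TopologicalSpace E] {φ : E → ι → ℝ}

omit [Fintype ι] in
theorem continuous_empiricalCov (hφ : Continuous φ) :
    Continuous (empiricalCov φ : (Fin n → E) → Matrix ι ι ℝ) := by
  refine continuous_matrix fun i k => ?_
  simp only [empiricalCov, Matrix.of_apply]
  fun_prop

omit [Fintype ι] in
theorem continuous_featureOutput (hφ : Continuous φ) :
    Continuous (featureOutput φ : (Fin n → E × ℝ) → EuclideanSpace ℝ ι) := by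
  unfold featureOutput
  fun_prop

variable [DecidableEq ι]

theorem continuous_sqrt_empiricalCov (hφ : Continuous φ) :
    Continuous fun y : (Fin n → E) × EuclideanSpace ℝ ι =>
      Matrix.toEuclideanCLM (𝕜 := ℝ) (CFC.sqrt (empiricalCov φ y.1)) y.2 := by
  have h := continuous_sqrt_comp (continuous_empiricalCov (n := n) hφ) (empiricalCov_posSemidef φ)
  have h' : ∀ i k, Continuous fun w : Fin n → E => CFC.sqrt (empiricalCov φ w) i k :=
    fun i k => h.matrix_elem i k
  have e : (fun y : (Fin n → E) × EuclideanSpace ℝ ι =>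
      Matrix.toEuclideanCLM (𝕜 := ℝ) (CFC.sqrt (empiricalCov φ y.1)) y.2)
      = fun y => WithLp.toLp 2 fun i => ∑ k, CFC.sqrt (empiricalCov φ y.1) i k * y.2 k := by
    ext y i
    simp [Matrix.mulVec, dotProduct]
  rw [e]
  exact (PiLp.continuous_toLp 2 _).comp (continuous_pi fun i => continuous_finsetSum _ fun k _ =>
    ((h' i k).comp continuous_fst).mul (by fun_prop))

variable [SecondCountableTopology E] [MeasurableSpace E] [BorelSpace E] {ν : Measure E}
  [IsProbabilityMeasure ν]

/-- Given its hidden features, the output of the network is Gaussian with covariance matrix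
`empiricalCov`. -/
theorem map_featureOutput_eq (hφ : Continuous φ) :
    (Measure.pi fun _ : Fin n => ν.prod (gaussianReal 0 1)).map (featureOutput φ)
      = ((Measure.pi fun _ : Fin n => ν).prod (stdGaussian (EuclideanSpace ℝ ι))).map
        fun y => Matrix.toEuclideanCLM (𝕜 := ℝ) (CFC.sqrt (empiricalCov φ y.1)) y.2 := by
  have hm1 := (continuous_featureOutput (n := n) hφ).measurable
  have hm2 := (continuous_sqrt_empiricalCov (n := n) hφ).measurable
  have := Measure.isProbabilityMeasure_map (μ := Measure.pi fun _ : Fin n =>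
    ν.prod (gaussianReal 0 1)) hm1.aemeasurable
  have := Measure.isProbabilityMeasure_map (μ := (Measure.pi fun _ : Fin n => ν).prod
    (stdGaussian (EuclideanSpace ℝ ι))) hm2.aemeasurable
  apply Measure.ext_of_charFun
  ext t
  -- Coefficient of a neuron's outer weight in `⟨f, t⟩`. Integrating out the Gaussian variables on
  -- either side leaves `exp (-a² / 2)` for each neuron.
  set a : E → ℝ := fun w => 1 / √(n : ℝ) * (φ w ⬝ᵥ t.ofLp) with ha
  have hac : Continuous a := by simp only [ha, dotProduct]; fun_prop
  have hl : charFun ((Measure.pi fun _ : Fin n => ν.prod (gaussianReal 0 1)).map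
      (featureOutput φ)) t = (∫ w, Complex.exp (-(a w : ℂ) ^ 2 / 2) ∂ν) ^ n := by
    rw [charFun_apply, integral_map hm1.aemeasurable (by fun_prop)]
    have h1 : ∀ ω : Fin n → E × ℝ, Complex.exp ((inner ℝ (featureOutput φ ω) t : ℝ) * Complex.I)
        = ∏ j, Complex.exp (((a (ω j).1 : ℂ) * (ω j).2) * Complex.I) := by
      intro ω
      rw [← Complex.exp_sum, ← Finset.sum_mul]
      congr 2
      simp only [← Complex.ofReal_mul, ← Complex.ofReal_sum, Complex.ofReal_inj]
      simp only [ha, featureOutput, PiLp.inner_apply, dotProduct, Finset.mul_sum, Finset.sum_mul,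
        RCLike.inner_apply, conj_trivial]
      rw [Finset.sum_comm]
      exact Finset.sum_congr rfl fun j _ => Finset.sum_congr rfl fun k _ => by ring
    simp_rw [h1]
    rw [integral_fintype_prod_eq_pow
      (fun x : E × ℝ => Complex.exp (((a x.1 : ℂ) * x.2) * Complex.I)), Fintype.card_fin,
      integral_prod]
    · congr 2
      ext w
      have := charFun_gaussianReal (μ := 0) (v := 1) (a w)
      rw [charFun_apply_real] at this
      simp only [this]
      simp
      ring_nf
    · refine Integrable.of_bound (Continuous.aestronglyMeasurable (by fun_prop)) 1
        (Filter.Eventually.of_forall fun x => ?_)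
      rw [← Complex.ofReal_mul, Complex.norm_exp_ofReal_mul_I]
  have hr : charFun (((Measure.pi fun _ : Fin n => ν).prod
      (stdGaussian (EuclideanSpace ℝ ι))).map
        fun y => Matrix.toEuclideanCLM (𝕜 := ℝ) (CFC.sqrt (empiricalCov φ y.1)) y.2) t
      = (∫ w, Complex.exp (-(a w : ℂ) ^ 2 / 2) ∂ν) ^ n := by
    rw [charFun_apply, integral_map hm2.aemeasurable (by fun_prop), integral_prod]
    · have h2 : ∀ w : Fin n → E, ∫ z, Complex.exp ((inner ℝ
          (Matrix.toEuclideanCLM (𝕜 := ℝ) (CFC.sqrt (empiricalCov φ w)) z) t : ℝ) * Complex.I)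
            ∂(stdGaussian (EuclideanSpace ℝ ι))
          = ∏ j, Complex.exp (-(a (w j) : ℂ) ^ 2 / 2) := by
        intro w
        have := charFun_multivariateGaussian (μ := 0) (empiricalCov_posSemidef φ w) t
        rw [charFun_apply, multivariateGaussian, integral_map (by fun_prop) (by fun_prop)] at this
        simp only [zero_add] at this
        rw [this, dotProduct_empiricalCov_mulVec, ← Complex.exp_sum]
        congr 1
        simp only [ha, neg_div, Finset.sum_neg_distrib, ← Finset.sum_div]
        simp
      simp_rw [h2]
      rw [integral_fintype_prod_eq_pow (fun w => Complex.exp (-(a w : ℂ) ^ 2 / 2)),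
        Fintype.card_fin]
    · refine Integrable.of_bound (Measurable.aestronglyMeasurable (by fun_prop)) 1
        (Filter.Eventually.of_forall fun x => ?_)
      rw [Complex.norm_exp_ofReal_mul_I]
  rw [hl, hr]

omit [DecidableEq ι] [SecondCountableTopology E] in
-- If `S v = 0` then `E (φ·v)² = v·Sv = 0`, so almost surely every neuron's feature vector is
-- orthogonal to `v`. This is what makes the Lipschitz bound for square roots applicable when `S` is
-- singular.
theorem ae_empiricalCov_mulVec_eq_zero (hφ : Continuous φ) {M : ℝ} (hM : ∀ w i, |φ w i| ≤ M)
    {S : Matrix ι ι ℝ} (hS : ∀ i k, S i k = ∫ w, φ w i * φ w k ∂ν) {v : ι → ℝ}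
    (hv : S *ᵥ v = 0) (n : ℕ) :
    ∀ᵐ w ∂(Measure.pi fun _ : Fin n => ν), empiricalCov φ w *ᵥ v = 0 := by
  have hi : ∀ i k, Integrable (fun w => φ w i * φ w k) ν := fun i k => by
    refine Integrable.of_bound (Continuous.aestronglyMeasurable (by fun_prop)) (M * M)
      (Filter.Eventually.of_forall fun w => ?_)
    rw [norm_mul]
    exact mul_le_mul (hM _ _) (hM _ _) (norm_nonneg _) ((abs_nonneg _).trans (hM w i))
  have e : ∀ w, (φ w ⬝ᵥ v) ^ 2 = ∑ i, ∑ k, v i * v k * (φ w i * φ w k) := fun w => by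
    rw [sq, dotProduct, Finset.sum_mul_sum]
    exact Finset.sum_congr rfl fun i _ => Finset.sum_congr rfl fun k _ => by ring
  have h0 : ∫ w, (φ w ⬝ᵥ v) ^ 2 ∂ν = v ⬝ᵥ S *ᵥ v := by
    simp_rw [e]
    rw [integral_finsetSum _ fun i _ => integrable_finsetSum _ fun k _ => (hi i k).const_mul _]
    simp only [dotProduct, Matrix.mulVec, Finset.mul_sum]
    refine Finset.sum_congr rfl fun i _ => ?_
    rw [integral_finsetSum _ fun k _ => (hi i k).const_mul _]
    refine Finset.sum_congr rfl fun k _ => ?_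
    rw [integral_const_mul, hS]
    ring
  rw [hv, dotProduct_zero, integral_eq_zero_iff_of_nonneg (fun w => sq_nonneg _)] at h0
  · have h1 : ∀ᵐ w ∂ν, φ w ⬝ᵥ v = 0 := by
      filter_upwards [h0] with w hw using by simpa using hw
    have h2 : ∀ᵐ w ∂(Measure.pi fun _ : Fin n => ν), ∀ j, φ (w j) ⬝ᵥ v = 0 :=
      ae_all_iff.2 fun j => (measurePreserving_eval (fun _ : Fin n => ν) j).quasiMeasurePreserving.ae
        h1
    filter_upwards [h2] with w hw
    rw [empiricalCov_mulVec]
    ext i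
    simp [hw]
  · simp_rw [e]
    exact integrable_finsetSum _ fun i _ => integrable_finsetSum _ fun k _ =>
      (hi i k).const_mul _

omit [DecidableEq ι] [SecondCountableTopology E] in
theorem exists_eLpNorm_empiricalCov_sub_le (hφ : Continuous φ) {M : ℝ} (hM : ∀ w i, |φ w i| ≤ M)
    {S : Matrix ι ι ℝ} (hS : ∀ i k, S i k = ∫ w, φ w i * φ w k ∂ν) {p : ℝ} (hp : 1 ≤ p) :
    ∃ C : ℝ, 0 ≤ C ∧ ∀ n : ℕ, 0 < n →
      eLpNorm (fun w : Fin n → E => ∑ i, ∑ k, |empiricalCov φ w i k - S i k|) (ENNReal.ofReal p)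
        (Measure.pi fun _ => ν) ≤ ENNReal.ofReal (C / √(n : ℝ)) := by
  obtain ⟨C, hC0, hC⟩ := exists_eLpNorm_sum_abs_mean_sub_integral_le (ν := ν)
    (h := fun (ik : ι × ι) w => φ w ik.1 * φ w ik.2)
    (fun ik => Continuous.measurable (by fun_prop)) (fun ik => ⟨1, one_pos, by
      refine Integrable.of_bound (Continuous.aestronglyMeasurable (by fun_prop))
        (Real.exp (M * M)) (Filter.Eventually.of_forall fun w => ?_)
      rw [Real.norm_eq_abs, Real.abs_exp, one_mul, abs_mul]
      exact Real.exp_le_exp.2 (mul_le_mul (hM _ _) (hM _ _) (abs_nonneg _)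
        ((abs_nonneg _).trans (hM w ik.1)))⟩) hp
  refine ⟨C, hC0, fun n hn => ?_⟩
  convert hC n hn using 3 with w
  simp only [Fintype.sum_prod_type, hS]
  rfl

/-- The output of the network is coupled with a Gaussian vector at `L^p` distance `O(1 / √n)`. -/
theorem exists_coupling_featureOutput_le (hφ : Continuous φ) {M : ℝ} (hM : ∀ w i, |φ w i| ≤ M)
    {S : Matrix ι ι ℝ} (hpos : S.PosSemidef) (hS : ∀ i k, S i k = ∫ w, φ w i * φ w k ∂ν)
    {p : ℝ} (hp : 1 ≤ p) :
    ∃ C : ℝ, 0 ≤ C ∧ ∀ n : ℕ, 0 < n →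
      ∃ γ ∈ Couplings ((Measure.pi fun _ : Fin n => ν.prod (gaussianReal 0 1)).map
          (featureOutput φ)) (multivariateGaussian 0 S),
        (∫⁻ z, edist z.1 z.2 ^ p ∂γ) ^ (1 / p) ≤ ENNReal.ofReal (C / √(n : ℝ)) := by
  have hp0 : 0 < p := by linarith
  obtain ⟨K, hK0, u, hu, hK⟩ := exists_norm_sqrt_sub_sqrt_le hpos
  obtain ⟨C, hC0, hC⟩ := exists_eLpNorm_empiricalCov_sub_le (ν := ν) hφ hM hS hp
  have hG : MemLp id (ENNReal.ofReal p) (stdGaussian (EuclideanSpace ℝ ι)) :=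
    IsGaussian.memLp_id _ _ ENNReal.ofReal_ne_top
  set G := eLpNorm id (ENNReal.ofReal p) (stdGaussian (EuclideanSpace ℝ ι)) with hGdef
  have hGtop : G ≠ ⊤ := hG.eLpNorm_ne_top
  refine ⟨K * C * G.toReal, by positivity, fun n hn => ?_⟩
  set P := (Measure.pi fun _ : Fin n => ν).prod (stdGaussian (EuclideanSpace ℝ ι)) with hP
  have hm := (continuous_sqrt_empiricalCov (n := n) hφ).measurable
  set f₁ := fun y : (Fin n → E) × EuclideanSpace ℝ ι =>
    Matrix.toEuclideanCLM (𝕜 := ℝ) (CFC.sqrt (empiricalCov φ y.1)) y.2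
  set f₂ := fun y : (Fin n → E) × EuclideanSpace ℝ ι =>
    Matrix.toEuclideanCLM (𝕜 := ℝ) (CFC.sqrt S) y.2
  have hm₂ : Measurable f₂ := by fun_prop
  -- Synchronous coupling: the same standard Gaussian vector drives both sides.
  refine ⟨P.map fun y => (f₁ y, f₂ y), ⟨?_, ?_⟩, ?_⟩
  · rw [Measure.map_map measurable_fst (hm.prodMk hm₂), map_featureOutput_eq hφ]
    rfl
  · rw [Measure.map_map measurable_snd (hm.prodMk hm₂), multivariateGaussian]
    have : (Prod.snd ∘ fun y => (f₁ y, f₂ y))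
        = (fun x => 0 + Matrix.toEuclideanCLM (𝕜 := ℝ) (CFC.sqrt S) x) ∘ Prod.snd := by
      ext y; simp [f₂]
    rw [this, ← Measure.map_map (by fun_prop) measurable_snd, hP, Measure.map_snd_prod]
    simp
  · rw [lintegral_map (by fun_prop) (hm.prodMk hm₂)]
    set D := fun w : Fin n → E => ∑ i, ∑ k, |empiricalCov φ w i k - S i k| with hD
    have hDc : Continuous D := by
      have hc := continuous_empiricalCov (n := n) hφ
      exact continuous_finsetSum _ fun i _ => continuous_finsetSum _ fun k _ =>
        ((hc.matrix_elem i k).sub continuous_const).abs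
    have hae : ∀ᵐ y ∂P, edist (f₁ y) (f₂ y) ^ p
        ≤ ENNReal.ofReal K ^ p * (‖D y.1‖ₑ ^ p * ‖y.2‖ₑ ^ p) := by
      have h1 : ∀ᵐ w ∂(Measure.pi fun _ : Fin n => ν), ∀ i, empiricalCov φ w *ᵥ u i = 0 :=
        ae_all_iff.2 fun i => ae_empiricalCov_mulVec_eq_zero hφ hM hS (hu i) n
      filter_upwards [Measure.quasiMeasurePreserving_fst.ae h1] with y hy
      rw [← ENNReal.mul_rpow_of_nonneg _ _ hp0.le, ← ENNReal.mul_rpow_of_nonneg _ _ hp0.le]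
      refine ENNReal.rpow_le_rpow ?_ hp0.le
      have h2 := hK _ (empiricalCov_posSemidef φ y.1) hy y.2
      have hD0 : 0 ≤ D y.1 := by positivity
      rw [edist_dist, dist_eq_norm, Real.enorm_of_nonneg hD0, ← ofReal_norm,
        ← ENNReal.ofReal_mul hD0, ← ENNReal.ofReal_mul hK0, ← mul_assoc]
      exact ENNReal.ofReal_le_ofReal h2
    -- The covariance error depends only on the hidden weights, which are independent of the
    -- Gaussian vector, so the `p`-th moment factors.
    have hcost : (∫⁻ y, edist (f₁ y) (f₂ y) ^ p ∂P) ^ (1 / p)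
        ≤ ENNReal.ofReal K * (eLpNorm D (ENNReal.ofReal p) (Measure.pi fun _ => ν) * G) := by
      refine (ENNReal.rpow_le_rpow (lintegral_mono_ae hae) (by positivity)).trans_eq ?_
      rw [lintegral_const_mul _ (by fun_prop), hP,
        lintegral_prod_mul (f := fun w => ‖D w‖ₑ ^ p) (g := fun z => ‖z‖ₑ ^ p)
          (by fun_prop) (by fun_prop),
        ENNReal.mul_rpow_of_nonneg _ _ (by positivity),
        ENNReal.mul_rpow_of_nonneg _ _ (by positivity), ← ENNReal.rpow_mul,
        mul_one_div_cancel hp0.ne', ENNReal.rpow_one, hGdef,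
        eLpNorm_eq_lintegral_rpow_enorm_toReal (by simpa using hp0) ENNReal.ofReal_ne_top,
        eLpNorm_eq_lintegral_rpow_enorm_toReal (by simpa using hp0) ENNReal.ofReal_ne_top,
        ENNReal.toReal_ofReal hp0.le]
      rfl
    refine hcost.trans ?_
    calc _ ≤ ENNReal.ofReal K * (ENNReal.ofReal (C / √(n : ℝ)) * ENNReal.ofReal G.toReal) := by
          rw [ENNReal.ofReal_toReal hGtop]
          gcongr
          exact hC n hn
      _ = _ := by
          rw [← ENNReal.ofReal_mul (by positivity), ← ENNReal.ofReal_mul hK0]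
          congr 1
          ring

end Coupling

/-! ### The empirical neural tangent kernel -/

section Gradient

variable {n₀ n₁ : ℕ}

theorem inputKernel_eq_sum_mul (x x' : Input n₀) :
    inputKernel x x' = ∑ i, (1 / √(n₀ : ℝ) * x i) * (1 / √(n₀ : ℝ) * x' i) := by
  have h : (1 / √(n₀ : ℝ)) * (1 / √(n₀ : ℝ)) = 1 / (n₀ : ℝ) := by
    rw [div_mul_div_comm, one_mul, Real.mul_self_sqrt (Nat.cast_nonneg _)]
  rw [inputKernel, Finset.mul_sum, ← h]
  exact Finset.sum_congr rfl fun i _ => by ring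

theorem hasGradientAt_network {Φ : ℝ → ℝ} (hΦ : Differentiable ℝ Φ) (x : Input n₀)
    (θ : Param n₀ n₁) :
    HasGradientAt (network Φ x) (WithLp.toLp 2 (Sum.elim
      (fun ij : Fin n₀ × Fin n₁ => 1 / √(n₁ : ℝ) *
        (deriv Φ (preactivation x θ ij.2) * (1 / √(n₀ : ℝ) * x ij.1) * θ (Sum.inr ij.2)))
      (fun j => 1 / √(n₁ : ℝ) * Φ (preactivation x θ j)))) θ := by
  let π : (Fin n₀ × Fin n₁) ⊕ Fin n₁ → Param n₀ n₁ →L[ℝ] ℝ := fun k => EuclideanSpace.proj k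
  let L : Fin n₁ → Param n₀ n₁ →L[ℝ] ℝ := fun j =>
    (1 / √(n₀ : ℝ)) • ∑ i, x i • π (Sum.inl (i, j))
  have hL : ∀ j, (fun θ : Param n₀ n₁ => preactivation x θ j) = L j := fun j => by
    ext θ
    simp [L, π, preactivation, sum_apply]
  have hpre : ∀ j, HasFDerivAt (fun θ : Param n₀ n₁ => preactivation x θ j) (L j) θ := fun j => by
    rw [hL]; exact (L j).hasFDerivAt
  have h := (HasFDerivAt.fun_sum (u := Finset.univ) fun j _ =>
    ((hΦ (preactivation x θ j)).hasDerivAt.comp_hasFDerivAt θ (hpre j)).mul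
      (π (Sum.inr j)).hasFDerivAt).const_mul (1 / √(n₁ : ℝ))
  rw [hasGradientAt_iff_hasFDerivAt]
  refine HasFDerivAt.congr_fderiv h ?_
  ext v
  simp only [InnerProductSpace.toDual_apply_apply, PiLp.inner_apply, Fintype.sum_sum_type,
    Fintype.sum_prod_type]
  rw [Finset.sum_comm, ← Finset.sum_add_distrib]
  simp only [smul_apply, sum_apply, add_apply, smul_eq_mul, Finset.mul_sum, L, π,
    EuclideanSpace.coe_proj, Function.comp_apply, Sum.elim_inl, Sum.elim_inr, RCLike.inner_apply,
    conj_trivial]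
  refine Finset.sum_congr rfl fun j _ => ?_
  rw [mul_add, add_comm, Finset.mul_sum]
  congr 1
  · exact Finset.sum_congr rfl fun i _ => by ring
  · ring

/-- The contribution of a single neuron to the empirical neural tangent kernel, in terms of the
preactivations and of the outer weight. -/
noncomputable def neuronKernel (Φ : ℝ → ℝ) (c a a' z : ℝ) : ℝ :=
  Φ a * Φ a' + c * (deriv Φ a * deriv Φ a') * z ^ 2

/-- Outer-weight derivatives give the `Φ Φ` term; for inner weights the sum over input coordinates
collapses to `inputKernel`. The kernel thus becomes a sample mean over neurons. -/
theorem ntk_eq {Φ : ℝ → ℝ} (hΦ : Differentiable ℝ Φ) (x x' : Input n₀) (θ : Param n₀ n₁) :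
    ntk Φ x x' θ = 1 / (n₁ : ℝ) * ∑ j, neuronKernel Φ (inputKernel x x')
      (preactivation x θ j) (preactivation x' θ j) (θ (Sum.inr j)) := by
  have h : (1 / √(n₁ : ℝ)) * (1 / √(n₁ : ℝ)) = 1 / (n₁ : ℝ) := by
    rw [div_mul_div_comm, one_mul, Real.mul_self_sqrt (Nat.cast_nonneg _)]
  rw [ntk, (hasGradientAt_network hΦ x θ).gradient, (hasGradientAt_network hΦ x' θ).gradient,
    PiLp.inner_apply, Fintype.sum_sum_type, Fintype.sum_prod_type, Finset.sum_comm,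
    ← Finset.sum_add_distrib, Finset.mul_sum]
  refine Finset.sum_congr rfl fun j _ => ?_
  simp only [Sum.elim_inl, Sum.elim_inr, RCLike.inner_apply, conj_trivial, neuronKernel, ← h,
    inputKernel_eq_sum_mul, mul_add, Finset.mul_sum, Finset.sum_mul]
  rw [add_comm]
  congr 1
  · ring
  · exact Finset.sum_congr rfl fun i _ => by ring

theorem measurable_empiricalPair {n : ℕ} {Φ : ℝ → ℝ} (hΦ : Differentiable ℝ Φ)
    (X : Fin n → Input n₀) : Measurable (empiricalPair Φ X : Param n₀ n₁ → Joint n) := by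
  have hc := hΦ.continuous.measurable
  have hd := measurable_deriv Φ
  have hp : ∀ (x : Input n₀) (j : Fin n₁),
      Measurable fun θ : Param n₀ n₁ => preactivation x θ j := fun x j => by
    unfold preactivation; fun_prop
  have hk : ∀ x x' : Input n₀, Measurable (ntk Φ x x' : Param n₀ n₁ → ℝ) := fun x x' => by
    -- The explicit formula needs only measurability of `deriv Φ`, which may be discontinuous.
    rw [funext (ntk_eq hΦ x x')]
    unfold neuronKernel
    fun_prop
  have hf : ∀ x : Input n₀, Measurable (network Φ x : Param n₀ n₁ → ℝ) := fun x => by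
    unfold network; fun_prop
  unfold empiricalPair
  fun_prop

end Gradient

/-! ### Decomposition of the initial law into neurons -/

section Neurons

variable {n₀ n₁ : ℕ}

/-- The preactivation of a single neuron with input weights `w`. -/
noncomputable def neuronPre (x w : Input n₀) : ℝ := 1 / √(n₀ : ℝ) * inner ℝ x w

/-- The parameters of a network, assembled from the weights of its neurons. -/
noncomputable def assemble (ω : Fin n₁ → Input n₀ × ℝ) : Param n₀ n₁ :=
  WithLp.toLp 2 (Sum.elim (fun ij => (ω ij.2).1 ij.1) fun j => (ω j).2)

/-- The law of the weights of a single neuron. -/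
noncomputable abbrev neuronLaw (n₀ : ℕ) : Measure (Input n₀ × ℝ) :=
  (stdGaussian (Input n₀)).prod (gaussianReal 0 1)

theorem measurable_assemble : Measurable (assemble : (Fin n₁ → Input n₀ × ℝ) → Param n₀ n₁) := by
  refine (WithLp.measurable_toLp 2 _).comp (measurable_pi_lambda _ fun k => ?_)
  rcases k with ij | j
  · simp only [Sum.elim_inl]; fun_prop
  · simp only [Sum.elim_inr]; fun_prop

theorem preactivation_assemble (x : Input n₀) (ω : Fin n₁ → Input n₀ × ℝ) (j : Fin n₁) :
    preactivation x (assemble ω) j = neuronPre x (ω j).1 := by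
  simp [preactivation, neuronPre, assemble, PiLp.inner_apply, mul_comm]

/-- Regroups the i.i.d. entries into i.i.d. neurons: both characteristic functions are `exp (-‖t‖² /
2)`. -/
theorem map_assemble_eq_initLaw :
    (Measure.pi fun _ : Fin n₁ => neuronLaw n₀).map assemble = initLaw n₀ n₁ := by
  rw [initLaw, map_pi_eq_stdGaussian]
  have := Measure.isProbabilityMeasure_map (μ := Measure.pi fun _ : Fin n₁ => neuronLaw n₀)
    measurable_assemble.aemeasurable
  apply Measure.ext_of_charFun
  ext t
  rw [charFun_stdGaussian, charFun_apply, integral_map measurable_assemble.aemeasurable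
    (by fun_prop)]
  set a : Fin n₁ → Input n₀ := fun j => WithLp.toLp 2 fun i => t (Sum.inl (i, j)) with ha
  have h1 : ∀ ω : Fin n₁ → Input n₀ × ℝ,
      Complex.exp ((inner ℝ (assemble ω) t : ℝ) * Complex.I)
      = ∏ j, (Complex.exp ((inner ℝ (ω j).1 (a j) : ℝ) * Complex.I)
        * Complex.exp ((t (Sum.inr j) : ℂ) * (ω j).2 * Complex.I)) := by
    intro ω
    simp_rw [← Complex.exp_add]
    rw [← Complex.exp_sum]
    congr 1
    simp_rw [← add_mul]
    rw [← Finset.sum_mul]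
    congr 1
    simp only [← Complex.ofReal_mul, ← Complex.ofReal_sum, ← Complex.ofReal_add,
      Complex.ofReal_inj]
    rw [PiLp.inner_apply, Fintype.sum_sum_type, Fintype.sum_prod_type, Finset.sum_comm,
      ← Finset.sum_add_distrib]
    simp [assemble, ha, PiLp.inner_apply]
  simp_rw [h1]
  rw [integral_fintype_prod_eq_prod (fun j (x : Input n₀ × ℝ) =>
    Complex.exp ((inner ℝ x.1 (a j) : ℝ) * Complex.I)
        * Complex.exp ((t (Sum.inr j) : ℂ) * x.2 * Complex.I))]
  have h2 : ∀ j, ∫ x, Complex.exp ((inner ℝ x.1 (a j) : ℝ) * Complex.I)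
        * Complex.exp ((t (Sum.inr j) : ℂ) * x.2 * Complex.I) ∂(neuronLaw n₀)
      = Complex.exp (-(‖a j‖ ^ 2 + t (Sum.inr j) ^ 2 : ℝ) / 2) := by
    intro j
    rw [integral_prod_mul (fun w : Input n₀ => Complex.exp ((inner ℝ w (a j) : ℝ) * Complex.I))
      (fun z : ℝ => Complex.exp ((t (Sum.inr j) : ℂ) * z * Complex.I)), ← charFun_apply,
      ← charFun_apply_real, charFun_stdGaussian, charFun_gaussianReal, ← Complex.exp_add]
    congr 1
    push_cast
    simp
    ring
  simp_rw [h2]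
  rw [← Complex.exp_sum, ← Finset.sum_div, Finset.sum_neg_distrib, ← Complex.ofReal_sum,
    ← Complex.ofReal_pow]
  congr 5
  rw [EuclideanSpace.real_norm_sq_eq, Fintype.sum_sum_type, Fintype.sum_prod_type,
    Finset.sum_comm, ← Finset.sum_add_distrib]
  simp [EuclideanSpace.real_norm_sq_eq, ha]

theorem pairExpectation_eq {g : ℝ → ℝ} (hg : Measurable g) (x x' : Input n₀) :
    pairExpectation g x x'
      = ∫ w, g (neuronPre x w) * g (neuronPre x' w) ∂(stdGaussian (Input n₀)) := by
  have hm : Measurable (fun w : Input n₀ => (WithLp.toLp 2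
      ![1 / √(n₀ : ℝ) * inner ℝ x w, 1 / √(n₀ : ℝ) * inner ℝ x' w] :
        EuclideanSpace ℝ (Fin 2))) := by
    refine (WithLp.measurable_toLp 2 _).comp (measurable_pi_lambda _ fun i => ?_)
    fin_cases i <;> simp <;> fun_prop
  rw [pairExpectation, ← map_stdGaussian_eq_pair,
    integral_map hm.aemeasurable (Measurable.aestronglyMeasurable (by fun_prop))]
  simp [neuronPre]

theorem integrable_mul_comp_neuronPre {g : ℝ → ℝ} (hg : Measurable g) {M : ℝ}
    (hM : ∀ z, |g z| ≤ M) (x x' : Input n₀) :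
    Integrable (fun w => g (neuronPre x w) * g (neuronPre x' w)) (stdGaussian (Input n₀)) := by
  unfold neuronPre
  refine Integrable.of_bound (Measurable.aestronglyMeasurable (by fun_prop)) (M * M)
    (Filter.Eventually.of_forall fun w => ?_)
  rw [norm_mul]
  exact mul_le_mul (hM _) (hM _) (norm_nonneg _) ((abs_nonneg _).trans (hM 0))

theorem integral_neuronKernel {Φ : ℝ → ℝ} (hΦ : Differentiable ℝ Φ) {M M' : ℝ}
    (hM : ∀ z, |Φ z| ≤ M) (hM' : ∀ z, |deriv Φ z| ≤ M') (x x' : Input n₀) :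
    ∫ y, neuronKernel Φ (inputKernel x x') (neuronPre x y.1) (neuronPre x' y.1) y.2
      ∂(neuronLaw n₀) = limitKernel Φ x x' := by
  have hc := hΦ.continuous.measurable
  have hd := measurable_deriv Φ
  have h1 := integrable_mul_comp_neuronPre hc hM x x'
  have h2 := integrable_mul_comp_neuronPre hd hM' x x'
  have hz : Integrable (fun z : ℝ => z ^ 2) (gaussianReal 0 1) :=
    (IsGaussian.memLp_id (gaussianReal 0 1) 2 (by simp)).integrable_sq
  have hz1 : ∫ z, z ^ 2 ∂(gaussianReal 0 1) = 1 := by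
    have := variance_eq_integral (μ := gaussianReal 0 1) (X := id) (by fun_prop)
    rw [variance_id_gaussianReal] at this
    simpa using this.symm
  simp only [neuronKernel]
  rw [integral_add (h1.comp_fst _) ((h2.const_mul _).mul_prod hz),
    integral_fun_fst (fun w => Φ (neuronPre x w) * Φ (neuronPre x' w)),
    integral_prod_mul (fun w => inputKernel x x' *
      (deriv Φ (neuronPre x w) * deriv Φ (neuronPre x' w))) (fun z => z ^ 2), hz1,
    integral_const_mul, limitKernel, gpKernel, pairExpectation_eq hc, pairExpectation_eq hd]
  simp

theorem exists_integrable_exp_neuronKernel {Φ : ℝ → ℝ} (hΦ : Differentiable ℝ Φ) {M M' : ℝ}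
    (hM : ∀ z, |Φ z| ≤ M) (hM' : ∀ z, |deriv Φ z| ≤ M') (x x' : Input n₀) :
    ∃ s : ℝ, 0 < s ∧ Integrable (fun y => Real.exp (s * |neuronKernel Φ (inputKernel x x')
      (neuronPre x y.1) (neuronPre x' y.1) y.2|)) (neuronLaw n₀) := by
  have hc := hΦ.continuous.measurable
  have hd := measurable_deriv Φ
  have hM0 : 0 ≤ M := (abs_nonneg _).trans (hM 0)
  have hM0' : 0 ≤ M' := (abs_nonneg _).trans (hM' 0)
  obtain ⟨C, hC0, hC⟩ := IsGaussian.exists_integrable_exp_sq (gaussianReal 0 1)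
  -- The neuron kernel is at most `M * M + b * z ^ 2`, and Fernique's theorem makes `exp (C * z ^
  -- 2)` integrable, whence the choice `s = C / b`. The `+ 1` keeps `b` positive when the first term
  -- vanishes.
  set b := |inputKernel x x'| * (M' * M') + 1 with hb
  have hb0 : 0 < b := by positivity
  refine ⟨C / b, by positivity, ((hC.comp_snd (stdGaussian (Input n₀))).const_mul
    (Real.exp (C / b * (M * M)))).mono' ?_ (Filter.Eventually.of_forall fun y => ?_)⟩
  · unfold neuronKernel neuronPre
    exact Measurable.aestronglyMeasurable (by fun_prop)
  · rw [Real.norm_eq_abs, Real.abs_exp, ← Real.exp_add, Real.exp_le_exp]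
    have h : |neuronKernel Φ (inputKernel x x') (neuronPre x y.1) (neuronPre x' y.1) y.2|
        ≤ M * M + b * y.2 ^ 2 := by
      refine (abs_add_le _ _).trans (add_le_add ?_ ?_)
      · rw [abs_mul]
        exact mul_le_mul (hM _) (hM _) (abs_nonneg _) hM0
      · rw [abs_mul, abs_mul, abs_mul, abs_of_nonneg (sq_nonneg y.2)]
        refine mul_le_mul_of_nonneg_right ?_ (sq_nonneg _)
        refine (mul_le_mul_of_nonneg_left (mul_le_mul (hM' _) (hM' _) (abs_nonneg _) hM0')
          (abs_nonneg _)).trans ?_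
        rw [hb]
        linarith
    calc _ ≤ C / b * (M * M + b * y.2 ^ 2) := by gcongr
      _ = _ := by
        rw [Real.norm_eq_abs, sq_abs]
        field_simp

end Neurons

/-! ### Gluing and the joint coupling -/

/-- A coupling whose first marginal is an image of `P` lifts to the source of `P`. -/
theorem exists_lift_of_map_fst_eq {Ω A B : Type*} [MeasurableSpace Ω] [MeasurableSpace A]
    [MeasurableSpace B] [StandardBorelSpace B] [Nonempty B] {P : Measure Ω}
    [IsProbabilityMeasure P] {f : Ω → A} (hf : Measurable f) {γ : Measure (A × B)}
    (hγ : γ.map Prod.fst = P.map f) :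
    ∃ ρ : Measure (Ω × B), ρ.map Prod.fst = P ∧ ρ.map (Prod.map f id) = γ := by
  have hP := Measure.isProbabilityMeasure_map (μ := P) hf.aemeasurable
  have hfst : γ.fst = P.map f := hγ
  have : IsFiniteMeasure γ := by
    refine ⟨?_⟩
    rw [← Measure.fst_univ, hfst]
    exact measure_lt_top _ _
  -- Given `ω`, the second coordinate is drawn from the conditional law of `γ` at `f ω`.
  refine ⟨P ⊗ₘ γ.condKernel.comap f hf, Measure.fst_compProd _ _, ?_⟩
  have hfm : Measurable (Prod.map f (id : B → B)) := hf.prodMap measurable_id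
  conv_rhs => rw [← γ.disintegrate γ.condKernel, hfst]
  ext s hs
  rw [Measure.map_apply hfm hs, Measure.compProd_apply (hfm hs), Measure.compProd_apply hs,
    lintegral_map (Kernel.measurable_kernel_prodMk_left hs) hf]
  rfl

theorem norm_toLp_le_sum_abs {κ : Type*} [Fintype κ] (a : κ → ℝ) :
    ‖(WithLp.toLp 2 a : EuclideanSpace ℝ κ)‖ ≤ ∑ k, |a k| := by
  rw [EuclideanSpace.norm_eq, Real.sqrt_le_left (Finset.sum_nonneg fun k _ => abs_nonneg _)]
  exact Finset.sum_sq_le_sq_sum_of_nonneg fun k _ => norm_nonneg _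

theorem edist_toLp_le {n : ℕ} (a b : Fin n × Fin n → ℝ) (v w : EuclideanSpace ℝ (Fin n)) :
    edist (WithLp.toLp 2 (WithLp.toLp 2 a, v) : Joint n) (WithLp.toLp 2 (WithLp.toLp 2 b, w))
      ≤ ‖∑ k, |a k - b k|‖ₑ + edist v w := by
  refine (edist_triangle _ (WithLp.toLp 2 (WithLp.toLp 2 b, v)) _).trans (add_le_add ?_ ?_)
  · rw [edist_dist, dist_eq_norm, ← WithLp.toLp_sub, Prod.mk_sub_mk, sub_self,
      WithLp.norm_toLp_fst, ← WithLp.toLp_sub,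
      Real.enorm_of_nonneg (Finset.sum_nonneg fun k _ => abs_nonneg _)]
    exact ENNReal.ofReal_le_ofReal (norm_toLp_le_sum_abs _)
  · rw [edist_dist, dist_eq_norm, ← WithLp.toLp_sub, Prod.mk_sub_mk, sub_self,
      WithLp.norm_toLp_snd, edist_dist, dist_eq_norm]

/-- Exhibits kernel and output as functions of the same neurons, so lifting the output coupling to
the neurons couples both at once. -/
theorem empiricalPair_assemble {n₀ n₁ n : ℕ} {Φ : ℝ → ℝ} (hΦ : Differentiable ℝ Φ)
    (X : Fin n → Input n₀) (ω : Fin n₁ → Input n₀ × ℝ) :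
    empiricalPair Φ X (assemble ω) = WithLp.toLp 2
      (WithLp.toLp 2 fun ij : Fin n × Fin n => 1 / (n₁ : ℝ) * ∑ j,
        neuronKernel Φ (inputKernel (X ij.1) (X ij.2)) (neuronPre (X ij.1) (ω j).1)
          (neuronPre (X ij.2) (ω j).1) (ω j).2,
        featureOutput (fun w i => Φ (neuronPre (X i) w)) ω) := by
  simp only [empiricalPair, ntk_eq hΦ, network, preactivation_assemble]
  rfl

/-- A coupling of the outputs yields a coupling of the joint laws, whose cost is bounded by that of
the given coupling and the deviation of the neural tangent kernel. -/
theorem wasserstein_initJointLaw_le {n₀ n₁ n : ℕ} {Φ : ℝ → ℝ} (hΦ : Differentiable ℝ Φ)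
    (X : Fin n → Input n₀) {p : ℝ} (hp : 1 ≤ p)
    {γ : Measure (EuclideanSpace ℝ (Fin n) × EuclideanSpace ℝ (Fin n))}
    (hγ : γ ∈ Couplings ((Measure.pi fun _ : Fin n₁ => neuronLaw n₀).map
      (featureOutput fun w i => Φ (neuronPre (X i) w))) (gpLaw Φ X)) :
    wasserstein p (initJointLaw n₁ Φ X) (limitJointLaw Φ X)
      ≤ eLpNorm (fun ω : Fin n₁ → Input n₀ × ℝ => ∑ ij : Fin n × Fin n,
          |1 / (n₁ : ℝ) * ∑ j, neuronKernel Φ (inputKernel (X ij.1) (X ij.2))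
            (neuronPre (X ij.1) (ω j).1) (neuronPre (X ij.2) (ω j).1) (ω j).2
            - limitKernel Φ (X ij.1) (X ij.2)|) (ENNReal.ofReal p)
          (Measure.pi fun _ => neuronLaw n₀)
        + (∫⁻ z, edist z.1 z.2 ^ p ∂γ) ^ (1 / p) := by
  have hp0 : 0 < p := by linarith
  have hc := hΦ.continuous.measurable
  have hd := measurable_deriv Φ
  have hcφ : Continuous fun (w : Input n₀) (i : Fin n) => Φ (neuronPre (X i) w) := by
    have := hΦ.continuous
    unfold neuronPre
    fun_prop
  have hf := (continuous_featureOutput (n := n₁) hcφ).measurable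
  set f := featureOutput (n := n₁) fun (w : Input n₀) (i : Fin n) => Φ (neuronPre (X i) w)
  set P := Measure.pi fun _ : Fin n₁ => neuronLaw n₀ with hP
  set H := fun ω : Fin n₁ → Input n₀ × ℝ => ∑ ij : Fin n × Fin n,
          |1 / (n₁ : ℝ) * ∑ j, neuronKernel Φ (inputKernel (X ij.1) (X ij.2))
            (neuronPre (X ij.1) (ω j).1) (neuronPre (X ij.2) (ω j).1) (ω j).2
            - limitKernel Φ (X ij.1) (X ij.2)| with hH
  have hHm : Measurable H := by
    simp only [hH, neuronKernel, neuronPre]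
    fun_prop
  -- The output alone does not determine the kernel, so the weights must be restored to the
  -- coupling.
  obtain ⟨ρ, hρ₁, hρ₂⟩ := exists_lift_of_map_fst_eq hf hγ.1
  have he := measurable_empiricalPair (n₁ := n₁) hΦ X
  have hea : Measurable fun ω : Fin n₁ → Input n₀ × ℝ => empiricalPair Φ X (assemble ω) :=
    he.comp measurable_assemble
  set q : EuclideanSpace ℝ (Fin n) → Joint n := fun g =>
    WithLp.toLp 2 (WithLp.toLp 2 fun ij : Fin n × Fin n => limitKernel Φ (X ij.1) (X ij.2), g)
    with hq
  have hqm : Measurable q := by fun_prop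
  have hT : Measurable fun y : (Fin n₁ → Input n₀ × ℝ) × EuclideanSpace ℝ (Fin n) =>
      (empiricalPair Φ X (assemble y.1), q y.2) :=
    (hea.comp measurable_fst).prodMk (hqm.comp measurable_snd)
  have hfm : Measurable (Prod.map f (id : EuclideanSpace ℝ (Fin n) → _)) :=
    hf.prodMap measurable_id
  refine (iInf₂_le (ρ.map fun y => (empiricalPair Φ X (assemble y.1), q y.2))
    ⟨?fst, ?snd⟩).trans ?cost
  case fst =>
    rw [Measure.map_map measurable_fst hT, initJointLaw, ← map_assemble_eq_initLaw,
      Measure.map_map he measurable_assemble, ← hP, ← hρ₁,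
      Measure.map_map (he.comp measurable_assemble) measurable_fst]
    rfl
  case snd =>
    have h2 : ρ.map Prod.snd = gpLaw Φ X := by
      rw [← hγ.2, ← hρ₂, Measure.map_map measurable_snd hfm]
      rfl
    rw [Measure.map_map measurable_snd hT, limitJointLaw, ← h2, Measure.map_map hqm measurable_snd]
    rfl
  case cost =>
    have hpt : ∀ y : (Fin n₁ → Input n₀ × ℝ) × EuclideanSpace ℝ (Fin n),
        edist (empiricalPair Φ X (assemble y.1)) (q y.2) ≤ ‖H y.1‖ₑ + edist (f y.1) y.2 :=
      fun y => by
        rw [empiricalPair_assemble hΦ]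
        exact edist_toLp_le _ _ _ _
    have hI₁ : ∫⁻ y, ‖H y.1‖ₑ ^ p ∂ρ = ∫⁻ ω, ‖H ω‖ₑ ^ p ∂P := by
      rw [← hρ₁, lintegral_map (by fun_prop) measurable_fst]
    have hI₂ : ∫⁻ y, edist (f y.1) y.2 ^ p ∂ρ = ∫⁻ z, edist z.1 z.2 ^ p ∂γ := by
      rw [← hρ₂, lintegral_map (by fun_prop) hfm]
      rfl
    rw [lintegral_map (by fun_prop) hT]
    calc (∫⁻ y, edist (empiricalPair Φ X (assemble y.1)) (q y.2) ^ p ∂ρ) ^ (1 / p)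
        ≤ (∫⁻ y, (‖H y.1‖ₑ + edist (f y.1) y.2) ^ p ∂ρ) ^ (1 / p) := by
          gcongr with y
          exact hpt y
      _ ≤ (∫⁻ y, ‖H y.1‖ₑ ^ p ∂ρ) ^ (1 / p) + (∫⁻ y, edist (f y.1) y.2 ^ p ∂ρ) ^ (1 / p) :=
          ENNReal.lintegral_Lp_add_le (f := fun y : (Fin n₁ → Input n₀ × ℝ) × _ => ‖H y.1‖ₑ)
            (g := fun y => edist (f y.1) y.2) (by fun_prop) (by fun_prop) hp
      _ = _ := by
          rw [hI₁, hI₂, eLpNorm_eq_lintegral_rpow_enorm_toReal (by simpa using hp0)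
            ENNReal.ofReal_ne_top, ENNReal.toReal_ofReal hp0.le]

end ShallowNTK

/-! ### Assembly of the kernel and output errors -/

open ShallowNTK in
theorem propositionB3 (n₀ n : ℕ) (Φ : ℝ → ℝ) (hΦ : Differentiable ℝ Φ)
    (hΦ_bdd : ∃ M : ℝ, ∀ z, |Φ z| ≤ M) (hΦ'_bdd : ∃ M : ℝ, ∀ z, |deriv Φ z| ≤ M)
    (X : Fin n → ShallowNTK.Input n₀) (p : ℝ) (hp : 1 ≤ p) :
    ∃ C : ℝ, 0 < C ∧ ∀ n₁ : ℕ, 0 < n₁ →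
      ShallowNTK.wasserstein p
        (ShallowNTK.initJointLaw n₁ Φ X) (ShallowNTK.limitJointLaw Φ X)
        ≤ ENNReal.ofReal (C / √(n₁ : ℝ)) := by
  obtain ⟨M, hM⟩ := hΦ_bdd
  obtain ⟨M', hM'⟩ := hΦ'_bdd
  have hc := hΦ.continuous.measurable
  have hcφ : Continuous fun (w : Input n₀) (i : Fin n) => Φ (neuronPre (X i) w) := by
    have := hΦ.continuous
    unfold neuronPre
    fun_prop
  obtain ⟨C₁, hC₁0, hC₁⟩ := exists_eLpNorm_sum_abs_mean_sub_integral_le (ν := neuronLaw n₀)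
    (h := fun (ij : Fin n × Fin n) y => neuronKernel Φ (inputKernel (X ij.1) (X ij.2))
      (neuronPre (X ij.1) y.1) (neuronPre (X ij.2) y.1) y.2)
    (fun ij => by unfold neuronKernel neuronPre; fun_prop)
    (fun ij => exists_integrable_exp_neuronKernel hΦ hM hM' (X ij.1) (X ij.2)) hp
  simp only [integral_neuronKernel hΦ hM hM'] at hC₁
  obtain ⟨C₂, hC₂0, hC₂⟩ := exists_coupling_featureOutput_le (ν := stdGaussian (Input n₀)) hcφ
    (fun w i => hM _) (gpCov_posSemidef hc hM X)
    (fun i k => by rw [Matrix.of_apply, gpKernel, pairExpectation_eq hc]) hp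
  -- The two error constants are only known to be nonnegative; the `+ 1` makes the constant strictly
  -- positive.
  refine ⟨C₁ + C₂ + 1, by positivity, fun n₁ hn₁ => ?_⟩
  obtain ⟨γ, hγ, hcost⟩ := hC₂ n₁ hn₁
  refine (wasserstein_initJointLaw_le hΦ X hp hγ).trans ((add_le_add (hC₁ n₁ hn₁) hcost).trans ?_)
  rw [← ENNReal.ofReal_add (by positivity) (by positivity), ← add_div]
  exact ENNReal.ofReal_le_ofReal (div_le_div_of_nonneg_right (by linarith) (Real.sqrt_nonneg _))
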